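/- Let $a,b\in\mathbb{C}$, $0<\lambda<\infty$, $0<\theta<\pi$ and $\mu<1$ be given ($\lambda,\theta,\mu$ real), and let $f$ be an entire function such that, as $|z|\to\infty$, $$f(z)=\begin{cases} z^a(\log z)^b\exp(z^\lambda)\,[1+o(1)] & \text{for } |\arg z|\le\theta,\\ O\!\left(\exp(\mu|z|^\lambda)\right) & \text{for } |\arg z|>\theta,\end{cases}$$ with each estimate holding uniformly in its sector (principal branches of $\arg$, $\log$ and powers). Let $$p_n(z)=\sum_{k=0}^n\frac{f^{(k)}(0)}{k!}z^k,\qquad r_n=\left(\frac{n}{\lambda}\right)^{1/\lambda},\qquad \operatorname{erfc}(z)=\frac{2}{\sqrt{\pi}}\int_z^{\infty}e^{-s^2}\,ds,$$ where the last contour is the horizontal ray from $z$ to $z+\infty$. Then, for every compact subset $K$ of the half-plane $\operatorname{Re} w<0$, one has $f(r_n(1+w/\sqrt n))\neq 0$ for all $w\in K$ once $n$ is large enough, and $$\lim_{n\to\infty}\frac{p_{n-1}\!\left(r_n(1+w/\sqrt n)\right)}{f\!\left(r_n(1+w/\sqrt n)\right)}=\frac12\operatorname{erfc}\!\left(w\sqrt{\lambda/2}\right)$$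 uniformly for $w\in K$. -/

import Mathlib

open Filter Topology Asymptotics

noncomputable section

/-- The `n`-th partial sum `∑_{k=0}^{n} f^{(k)}(0) / k! * z^k` of the Maclaurin series of `f`. -/
def maclaurinPartialSum (f : ℂ → ℂ) (n : ℕ) (z : ℂ) : ℂ :=
  ∑ k ∈ Finset.range (n + 1), iteratedDeriv k f 0 / (Nat.factorial k : ℂ) * z ^ k

/-- The complementary error function of a complex variable,
`(2 / √π) ∫_z^{z + ∞} exp (-s ^ 2) ds`, along the horizontal ray `s = z + t`, `t > 0`. -/
def complexErfc (z : ℂ) : ℂ :=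
  (2 / (Real.sqrt Real.pi : ℂ)) * ∫ t in Set.Ioi (0 : ℝ), Complex.exp (-(z + (t : ℂ)) ^ 2)

/-- The scaling radius `r_n = (n / λ) ^ (1 / λ)`. -/
def scalingRadius (lam : ℝ) (n : ℕ) : ℝ :=
  ((n : ℝ) / lam) ^ (1 / lam)

/-- The point `r_n (1 + w / √n)`. -/
def cornerPoint (lam : ℝ) (n : ℕ) (w : ℂ) : ℂ :=
  (scalingRadius lam n : ℂ) * (1 + w / (Real.sqrt (n : ℝ) : ℂ))

/-- The neighbourhoods of infinity within the closed sector `|arg z| ≤ θ`. Asymptotic relations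
along this filter are those that hold as `|z| → ∞`, uniformly in the sector. -/
def sectorAtInfinity (θ : ℝ) : Filter ℂ :=
  Bornology.cobounded ℂ ⊓ 𝓟 {z : ℂ | |Complex.arg z| ≤ θ}

/-- The neighbourhoods of infinity within the complementary sector `|arg z| > θ`. -/
def cosectorAtInfinity (θ : ℝ) : Filter ℂ :=
  Bornology.cobounded ℂ ⊓ 𝓟 {z : ℂ | θ < |Complex.arg z|}

/-- `f` has one direction of maximal exponential growth, the positive real axis: as `|z| → ∞`,
`f z = z ^ a (log z) ^ b exp (z ^ λ) (1 + o(1))` uniformly for `|arg z| ≤ θ`, and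
`f z = O(exp (μ |z| ^ λ))` uniformly for `|arg z| > θ`. Powers and logarithms are principal. -/
def HasOneDirectionGrowth (f : ℂ → ℂ) (a b : ℂ) (lam θ μ : ℝ) : Prop :=
  (∃ δ : ℂ → ℂ, Tendsto δ (sectorAtInfinity θ) (𝓝 0) ∧
    ∀ᶠ z in sectorAtInfinity θ,
      f z = z ^ a * (Complex.log z) ^ b * Complex.exp (z ^ (lam : ℂ)) * (1 + δ z)) ∧
  f =O[cosectorAtInfinity θ] fun z : ℂ => Real.exp (μ * ‖z‖ ^ lam)

end

/-! Put `q = 1 + w/√n` and let `M_n` be `growthScale`. Cauchy's formula on the circle of radius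
`r_n` writes `f(r_n q) - p_{n-1}(r_n q)` as `q^n/(2π)` times the integral over `φ ∈ [-π, π]` of
`f(r_n e^{iφ}) e^{-inφ} · e^{iφ}/(e^{iφ} - q)`. It applies because `Re w < 0` puts `q` inside the
unit disc for large `n`. Write `H_n(ℓ) = f(r_n e^ℓ) e^{-nℓ}/M_n` (`normalizedGrowth`). Then `f(r_n
q) = H_n(log q) q^n M_n`, so the powers `q^n` and the scale `M_n` cancel and `1 - p_{n-1}/f = J_n /
(2π H_n(log q))`, where `J_n` integrates `H_n(iφ)` against the Cauchy kernel.

Since `r_n^λ = n/λ`, the exponent of `H_n` is `(n/λ)(e^{λℓ} - 1) - nℓ`, with a saddle at `ℓ = 0`.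
Hence `H_n(ℓ) → exp(λv²/2)` whenever `√n ℓ → v` (`tendsto_normalizedGrowth`). The denominator has `v
= w`. In `J_n`, the substitution `φ = t/√n` gives the limit `∫ exp(-λt²/2)/(it - w) dt`
(`tendsto_integral_remainderIntegrand`), which `integral_gaussian_div_sub` evaluates as `π
exp(λw²/2) erfc(-w√(λ/2))`. The reflection `erfc(z) + erfc(-z) = 2` finishes the computation.

Uniformity comes from taking every limit jointly along `atTop ×ˢ 𝓝 w₀`; compactness of `K` and
continuity of `erfc` do the rest. -/

section

open MeasureTheory

/-! ### Cauchy's formula for the Maclaurin remainder -/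

/-- Periodicity allows the angle to be centred at `0`: the saddle becomes interior and the angle
agrees with the principal argument. -/
theorem circleIntegral_eq_integral_neg_pi_pi (g : ℂ → ℂ) (r : ℝ) :
    (∮ ζ in C(0, r), g ζ) =
      ∫ φ in (-Real.pi)..Real.pi, (r * Complex.exp (φ * Complex.I) * Complex.I) *
        g (r * Complex.exp (φ * Complex.I)) := by
  have hper : Function.Periodic
      (fun φ : ℝ => deriv (circleMap 0 r) φ • g (circleMap 0 r φ)) (2 * Real.pi) := by
    intro φ
    simp only [deriv_circleMap, periodic_circleMap 0 r φ]
  have h := hper.intervalIntegral_add_eq 0 (-Real.pi)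
  rw [circleIntegral]
  rw [zero_add, show -Real.pi + 2 * Real.pi = Real.pi by ring] at h
  rw [h]
  refine intervalIntegral.integral_congr fun φ _ => ?_
  simp [deriv_circleMap, circleMap]

/-- The finite geometric series of the Cauchy kernel with exact remainder, so that no interchange of
limit and integral is needed. -/
theorem inv_sub_mul_eq_sum_add {ζ z : ℂ} (h0 : ζ ≠ 0) (h1 : ζ - z ≠ 0) (c : ℂ) (n : ℕ) :
    (ζ - z)⁻¹ * c = ∑ k ∈ Finset.range n, z ^ k * (c / ζ ^ (k + 1)) +
      z ^ n * (c / (ζ ^ n * (ζ - z))) := by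
  induction n with
  | zero => simp; field_simp
  | succ n ih =>
    rw [Finset.sum_range_succ, add_assoc, ih]
    congr 1
    field_simp
    ring

/-- Cauchy's integral formula for the remainder of the Maclaurin expansion. -/
theorem sub_sum_maclaurin_eq_circleIntegral {f : ℂ → ℂ} (hf : Differentiable ℂ f) {r : ℝ}
    {z : ℂ} (hz : ‖z‖ < r) (n : ℕ) :
    f z - ∑ k ∈ Finset.range n, iteratedDeriv k f 0 / (Nat.factorial k : ℂ) * z ^ k =
      z ^ n / (2 * Real.pi * Complex.I) * ∮ ζ in C(0, r), f ζ / (ζ ^ n * (ζ - z)) := by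
  have hr : 0 < r := (norm_nonneg z).trans_lt hz
  have h2 : (2 * Real.pi * Complex.I : ℂ) ≠ 0 := Complex.two_pi_I_ne_zero
  have hzero : ∀ ζ ∈ Metric.sphere (0 : ℂ) r, ζ ≠ 0 := by
    intro ζ hζ h
    simp [h] at hζ
    exact hr.ne hζ
  have hne : ∀ ζ ∈ Metric.sphere (0 : ℂ) r, ζ - z ≠ 0 := by
    intro ζ hζ h
    rw [sub_eq_zero] at h
    simp [h] at hζ
    exact hz.ne hζ
  have hC : (∮ ζ in C(0, r), (ζ - z)⁻¹ • f ζ) = (2 * Real.pi * Complex.I : ℂ) • f z :=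
    hf.diffContOnCl.circleIntegral_sub_inv_smul (by simpa using hz)
  have hD : ∀ k, (∮ ζ in C(0, r), f ζ / ζ ^ (k + 1)) =
      (2 * Real.pi * Complex.I) * (iteratedDeriv k f 0 / (Nat.factorial k : ℂ)) := by
    intro k
    have := DiffContOnCl.circleIntegral_one_div_sub_center_pow_smul hr k
      (c := 0) (f := f) hf.diffContOnCl
    simp only [sub_zero, smul_eq_mul, one_div_mul_eq_div] at this
    rw [this]
    ring
  have hint : ∀ k, CircleIntegrable (fun ζ => z ^ k * (f ζ / ζ ^ (k + 1))) 0 r := by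
    intro k
    refine ContinuousOn.circleIntegrable hr.le ?_
    exact continuousOn_const.mul (hf.continuous.continuousOn.div (by fun_prop)
      fun ζ hζ => pow_ne_zero _ (hzero ζ hζ))
  have hint2 : CircleIntegrable (fun ζ => z ^ n * (f ζ / (ζ ^ n * (ζ - z)))) 0 r := by
    refine ContinuousOn.circleIntegrable hr.le ?_
    exact continuousOn_const.mul (hf.continuous.continuousOn.div (by fun_prop)
      fun ζ hζ => mul_ne_zero (pow_ne_zero _ (hzero ζ hζ)) (hne ζ hζ))
  have hsplit : (∮ ζ in C(0, r), (ζ - z)⁻¹ • f ζ) =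
      (∑ k ∈ Finset.range n, ∮ ζ in C(0, r), z ^ k * (f ζ / ζ ^ (k + 1))) +
        ∮ ζ in C(0, r), z ^ n * (f ζ / (ζ ^ n * (ζ - z))) := by
    rw [← circleIntegral.integral_fun_sum fun k _ => hint k,
      ← circleIntegral.integral_add (CircleIntegrable.fun_sum _ fun k _ => hint k) hint2]
    refine circleIntegral.integral_congr hr.le fun ζ hζ => ?_
    have h0 := hzero ζ hζ
    have h1 := hne ζ hζ
    exact inv_sub_mul_eq_sum_add h0 h1 (f ζ) n
  rw [hC] at hsplit
  simp only [circleIntegral.integral_const_mul, hD, smul_eq_mul] at hsplit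
  rw [div_mul_eq_mul_div, eq_div_iff h2, ← add_sub_cancel_left
    (∑ k ∈ Finset.range n, z ^ k * (2 * Real.pi * Complex.I *
      (iteratedDeriv k f 0 / (Nat.factorial k : ℂ)))) (z ^ n * _), ← hsplit, sub_mul,
    Finset.sum_mul]
  congr 1
  · ring
  · exact Finset.sum_congr rfl fun k _ => by ring

theorem sub_sum_maclaurin_eq_integral {f : ℂ → ℂ} (hf : Differentiable ℂ f) {r : ℝ} (hr : 0 < r)
    {q : ℂ} (hq : ‖q‖ < 1) (n : ℕ) :
    f (r * q) - ∑ k ∈ Finset.range n,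
        iteratedDeriv k f 0 / (Nat.factorial k : ℂ) * (r * q) ^ k =
      q ^ n / (2 * Real.pi) * ∫ φ in (-Real.pi)..Real.pi,
        f (r * Complex.exp (φ * Complex.I)) * Complex.exp (-(n * (φ * Complex.I))) *
          (Complex.exp (φ * Complex.I) / (Complex.exp (φ * Complex.I) - q)) := by
  have hz : ‖(r : ℂ) * q‖ < r := by
    rw [norm_mul, Complex.norm_real, Real.norm_of_nonneg hr.le]
    nlinarith
  rw [sub_sum_maclaurin_eq_circleIntegral hf hz, circleIntegral_eq_integral_neg_pi_pi,
    ← intervalIntegral.integral_const_mul, ← intervalIntegral.integral_const_mul]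
  refine intervalIntegral.integral_congr fun φ _ => ?_
  have hr' : (r : ℂ) ≠ 0 := by exact_mod_cast hr.ne'
  have hpi : (Real.pi : ℂ) ≠ 0 := by exact_mod_cast Real.pi_ne_zero
  have he := Complex.exp_ne_zero (φ * Complex.I)
  have hden : Complex.exp (φ * Complex.I) - q ≠ 0 := by
    intro h
    rw [sub_eq_zero] at h
    rw [← h, Complex.norm_exp_ofReal_mul_I] at hq
    exact lt_irrefl _ hq
  simp only [Complex.exp_neg, Complex.exp_nat_mul]
  rw [← mul_sub, mul_pow, mul_pow]
  field_simp

/-! ### Normalised growth and its limit at the saddle point -/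

noncomputable section

/-- The size `r ^ a * (log r) ^ b * exp (r ^ λ)` of the dominant growth at the scaling radius. -/
def growthScale (a b : ℂ) (lam : ℝ) (n : ℕ) : ℂ :=
  (scalingRadius lam n : ℂ) ^ a * ((Real.log (scalingRadius lam n) : ℝ) : ℂ) ^ b *
    Complex.exp ((n / lam : ℝ) : ℂ)

/-- The function `f (r_n * exp ℓ) * exp (-n ℓ)` relative to the dominant growth. -/
def normalizedGrowth (f : ℂ → ℂ) (a b : ℂ) (lam : ℝ) (n : ℕ) (ℓ : ℂ) : ℂ :=
  f (scalingRadius lam n * Complex.exp ℓ) * Complex.exp (-(n * ℓ)) / growthScale a b lam n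

end

theorem tendsto_natCast_div_atTop {lam : ℝ} (hlam : 0 < lam) :
    Tendsto (fun n : ℕ => (n : ℝ) / lam) atTop atTop :=
  tendsto_natCast_atTop_atTop.atTop_div_const hlam

theorem tendsto_scalingRadius {lam : ℝ} (hlam : 0 < lam) :
    Tendsto (scalingRadius lam) atTop atTop :=
  (tendsto_rpow_atTop (by positivity)).comp (tendsto_natCast_div_atTop hlam)

theorem scalingRadius_rpow {lam : ℝ} (hlam : 0 < lam) (n : ℕ) :
    scalingRadius lam n ^ lam = n / lam := by
  rw [scalingRadius, ← Real.rpow_mul (by positivity), one_div_mul_cancel hlam.ne', Real.rpow_one]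

theorem growthScale_ne_zero {a b : ℂ} {lam : ℝ} {n : ℕ} (h : 1 < scalingRadius lam n) :
    growthScale a b lam n ≠ 0 := by
  have h1 : ((scalingRadius lam n : ℝ) : ℂ) ≠ 0 := by exact_mod_cast (zero_lt_one.trans h).ne'
  have h2 : ((Real.log (scalingRadius lam n) : ℝ) : ℂ) ≠ 0 := by
    exact_mod_cast (Real.log_pos h).ne'
  simp [growthScale, Complex.cpow_eq_zero_iff, h1, h2, Complex.exp_ne_zero]

/-- Exact form of the normalised growth where the asymptotic formula has relative error `d`. -/
theorem normalizedGrowth_eq {f : ℂ → ℂ} {a b : ℂ} {lam : ℝ} (hlam : 0 < lam) {n : ℕ} {ℓ d : ℂ}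
    (hr : 1 < scalingRadius lam n) (him : |ℓ.im| < Real.pi)
    (hℓ : ‖ℓ‖ < Real.log (scalingRadius lam n))
    (hf : f (scalingRadius lam n * Complex.exp ℓ) =
      (scalingRadius lam n * Complex.exp ℓ) ^ a *
        Complex.log (scalingRadius lam n * Complex.exp ℓ) ^ b *
        Complex.exp ((scalingRadius lam n * Complex.exp ℓ) ^ (lam : ℂ)) * (1 + d)) :
    normalizedGrowth f a b lam n ℓ =
      Complex.exp (a * ℓ) * (1 + ℓ / (Real.log (scalingRadius lam n) : ℝ)) ^ b *
        Complex.exp ((n / lam : ℝ) * (Complex.exp (lam * ℓ) - 1) - n * ℓ) * (1 + d) := by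
  have hr0 := zero_lt_one.trans hr
  have hlog := Real.log_pos hr
  have hrl := scalingRadius_rpow hlam n
  have hM := growthScale_ne_zero (a := a) (b := b) hr
  rw [normalizedGrowth, div_eq_iff hM, hf, growthScale]
  generalize scalingRadius lam n = r at *
  have hrC : (r : ℂ) ≠ 0 := by exact_mod_cast hr0.ne'
  have hLC : ((Real.log r : ℝ) : ℂ) ≠ 0 := by exact_mod_cast hlog.ne'
  have hlogz : Complex.log (r * Complex.exp ℓ) = Real.log r + ℓ := by
    rw [Complex.log_ofReal_mul hr0 (Complex.exp_ne_zero _),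
      Complex.log_exp (by linarith [(abs_lt.1 him).1]) (abs_lt.1 him).2.le]
  have hz : (r : ℂ) * Complex.exp ℓ ≠ 0 := mul_ne_zero hrC (Complex.exp_ne_zero _)
  have hpow : ∀ c : ℂ, ((r : ℂ) * Complex.exp ℓ) ^ c = (r : ℂ) ^ c * Complex.exp (c * ℓ) := by
    intro c
    rw [Complex.cpow_def_of_ne_zero hz, Complex.cpow_def_of_ne_zero hrC, hlogz,
      ← Complex.exp_add, Complex.ofReal_log hr0.le]
    ring_nf
  -- This is where `‖ℓ‖ < log r` enters. Pulling the positive real factor `log r` out of the power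
  -- below is then legitimate for principal branches.
  have hne : 1 + ℓ / (Real.log r : ℝ) ≠ 0 := by
    intro h
    have h' : ℓ = -(Real.log r : ℝ) := by
      field_simp at h
      linear_combination h
    rw [h', norm_neg, Complex.norm_real, Real.norm_of_nonneg hlog.le] at hℓ
    exact lt_irrefl _ hℓ
  have hlogpow : ((Real.log r : ℝ) + ℓ) ^ b =
      ((Real.log r : ℝ) : ℂ) ^ b * (1 + ℓ / (Real.log r : ℝ)) ^ b := by
    have h1 : ((Real.log r : ℝ) + ℓ) = (Real.log r : ℝ) * (1 + ℓ / (Real.log r : ℝ)) := by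
      field_simp
    rw [h1, Complex.cpow_def_of_ne_zero (mul_ne_zero hLC hne), Complex.cpow_def_of_ne_zero hLC,
      Complex.cpow_def_of_ne_zero hne, Complex.log_ofReal_mul hlog hne, ← Complex.exp_add,
      Complex.ofReal_log hlog.le]
    ring_nf
  have hexp : ((r : ℂ) ^ (lam : ℂ)) = ((n / lam : ℝ) : ℂ) := by
    rw [← hrl, Complex.ofReal_cpow hr0.le]
  rw [hpow a, hpow lam, hlogz, hlogpow, hexp]
  have : Complex.exp ((n / lam : ℝ) * Complex.exp (lam * ℓ)) * Complex.exp (-(n * ℓ)) =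
      Complex.exp ((n / lam : ℝ) * (Complex.exp (lam * ℓ) - 1) - n * ℓ) *
        Complex.exp ((n / lam : ℝ) : ℂ) := by
    rw [← Complex.exp_add, ← Complex.exp_add]
    ring_nf
  linear_combination (r : ℂ) ^ a * Complex.exp (a * ℓ) * (((Real.log r : ℝ) : ℂ) ^ b *
    (1 + ℓ / (Real.log r : ℝ)) ^ b) * (1 + d) * this

theorem tendsto_scalingRadius_mul_exp_cobounded {ι : Type*} {l : Filter ι} {lam : ℝ}
    (hlam : 0 < lam) {N : ι → ℕ} {ℓ : ι → ℂ} (hN : Tendsto N l atTop)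
    (hre : Tendsto (fun i => (ℓ i).re) l (𝓝 0)) :
    Tendsto (fun i => (scalingRadius lam (N i) : ℂ) * Complex.exp (ℓ i)) l
      (Bornology.cobounded ℂ) := by
  rw [← tendsto_norm_atTop_iff_cobounded]
  have h1 : Tendsto (fun i => Real.exp (ℓ i).re) l (𝓝 1) := by
    simpa [Function.comp_def] using (Real.continuous_exp.tendsto 0).comp hre
  refine (((tendsto_scalingRadius hlam).comp hN).atTop_mul_pos one_pos h1).congr fun i => ?_
  have : 0 ≤ scalingRadius lam (N i) := by unfold scalingRadius; positivity
  simp [Complex.norm_exp, abs_of_nonneg this]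

theorem arg_ofReal_mul_exp {r : ℝ} (hr : 0 < r) {ℓ : ℂ} (h1 : -Real.pi < ℓ.im)
    (h2 : ℓ.im ≤ Real.pi) : Complex.arg (r * Complex.exp ℓ) = ℓ.im := by
  rw [Complex.arg_real_mul _ hr, ← Complex.log_im, Complex.log_exp h1 h2]

theorem tendsto_scalingRadius_mul_exp_sector {ι : Type*} {l : Filter ι} {lam θ : ℝ}
    (hlam : 0 < lam) (hθπ : θ < Real.pi) {N : ι → ℕ} {ℓ : ι → ℂ} (hN : Tendsto N l atTop)
    (hre : Tendsto (fun i => (ℓ i).re) l (𝓝 0)) (him : ∀ᶠ i in l, |(ℓ i).im| ≤ θ) :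
    Tendsto (fun i => (scalingRadius lam (N i) : ℂ) * Complex.exp (ℓ i)) l
      (sectorAtInfinity θ) := by
  refine tendsto_inf.2 ⟨tendsto_scalingRadius_mul_exp_cobounded hlam hN hre, ?_⟩
  rw [tendsto_principal]
  filter_upwards [him, ((tendsto_scalingRadius hlam).comp hN).eventually_gt_atTop 0] with i hi hr
  have := abs_le.1 hi
  simp only [Function.comp_apply] at hr
  change |Complex.arg _| ≤ θ
  rwa [arg_ofReal_mul_exp hr (by linarith) (by linarith)]

theorem tendsto_log_scalingRadius {lam : ℝ} (hlam : 0 < lam) :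
    Tendsto (fun n => Real.log (scalingRadius lam n)) atTop atTop :=
  Real.tendsto_log_atTop.comp (tendsto_scalingRadius hlam)

theorem norm_exp_sub_quadratic_le {x : ℂ} (hx : ‖x‖ ≤ 1) :
    ‖Complex.exp x - 1 - x - x ^ 2 / 2‖ ≤ ‖x‖ ^ 3 := by
  have h := Complex.exp_bound hx (n := 3) (by norm_num)
  simp only [Finset.sum_range_succ, Finset.sum_range_zero, Nat.factorial, pow_zero, pow_one] at h
  norm_num at h
  have h3 : 0 ≤ ‖x‖ ^ 3 := by positivity
  calc ‖Complex.exp x - 1 - x - x ^ 2 / 2‖ = ‖Complex.exp x - (1 + x + x ^ 2 / 2)‖ := by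
        congr 1; ring
    _ ≤ ‖x‖ ^ 3 * (2 / 9) := h
    _ ≤ ‖x‖ ^ 3 := by linarith

theorem tendsto_sqrt_natCast {ι : Type*} {l : Filter ι} {N : ι → ℕ} (hN : Tendsto N l atTop) :
    Tendsto (fun i => Real.sqrt (N i)) l atTop :=
  Real.tendsto_sqrt_atTop.comp (tendsto_natCast_atTop_atTop.comp hN)

theorem tendsto_zero_of_sqrt_mul_tendsto {ι : Type*} {l : Filter ι} {N : ι → ℕ} {ℓ : ι → ℂ}
    {v : ℂ} (hN : Tendsto N l atTop)
    (hℓ : Tendsto (fun i => (Real.sqrt (N i) : ℂ) * ℓ i) l (𝓝 v)) : Tendsto ℓ l (𝓝 0) := by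
  have h1 : Tendsto (fun i => (((Real.sqrt (N i))⁻¹ : ℝ) : ℂ)) l (𝓝 0) := by
    have := (Complex.continuous_ofReal.tendsto 0).comp
      (tendsto_inv_atTop_zero.comp (tendsto_sqrt_natCast hN))
    simpa [Function.comp_def] using this
  have h2 := h1.mul hℓ
  rw [zero_mul] at h2
  refine h2.congr' ?_
  filter_upwards [(tendsto_sqrt_natCast hN).eventually_gt_atTop 0] with i hi
  have : (Real.sqrt (N i) : ℂ) ≠ 0 := by exact_mod_cast hi.ne'
  push_cast
  field_simp

/-- The exponent of the saddle point, at distance of order `1 / √n`. -/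
theorem tendsto_saddle_exponent {ι : Type*} {l : Filter ι} {lam : ℝ} (hlam : 0 < lam)
    {N : ι → ℕ} {ℓ : ι → ℂ} {v : ℂ} (hN : Tendsto N l atTop)
    (hℓ : Tendsto (fun i => (Real.sqrt (N i) : ℂ) * ℓ i) l (𝓝 v)) :
    Tendsto (fun i => ((N i / lam : ℝ) : ℂ) * (Complex.exp (lam * ℓ i) - 1) - N i * ℓ i) l
      (𝓝 (lam * v ^ 2 / 2)) := by
  have h0 := tendsto_zero_of_sqrt_mul_tendsto hN hℓ
  have hlamC : (lam : ℂ) ≠ 0 := by exact_mod_cast hlam.ne'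
  have hsq : ∀ i, ((N i : ℕ) : ℂ) = (Real.sqrt (N i) : ℂ) ^ 2 := by
    intro i
    rw [← Complex.ofReal_pow, Real.sq_sqrt (Nat.cast_nonneg _), Complex.ofReal_natCast]
  have hmain : Tendsto (fun i => (lam : ℂ) * ((Real.sqrt (N i) : ℂ) * ℓ i) ^ 2 / 2) l
      (𝓝 (lam * v ^ 2 / 2)) := ((hℓ.pow 2).const_mul _).div_const _
  -- The linear terms cancel exactly. The cubic error `(n/λ)‖λℓ‖³` equals `λ²‖√n ℓ‖²‖ℓ‖`, a bounded
  -- quantity times one tending to zero.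
  have herr : Tendsto (fun i => ((N i / lam : ℝ) : ℂ) *
      (Complex.exp (lam * ℓ i) - 1 - lam * ℓ i - (lam * ℓ i) ^ 2 / 2)) l (𝓝 0) := by
    have hb : Tendsto (fun i => lam ^ 2 * ‖(Real.sqrt (N i) : ℂ) * ℓ i‖ ^ 2 * ‖ℓ i‖) l (𝓝 0) := by
      have := ((hℓ.norm.pow 2).const_mul (lam ^ 2)).mul h0.norm
      simpa using this
    refine squeeze_zero_norm' ?_ hb
    have hx : Tendsto (fun i => ‖(lam : ℂ) * ℓ i‖) l (𝓝 0) := by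
      simpa using (h0.const_mul (lam : ℂ)).norm
    filter_upwards [hx.eventually_le_const zero_lt_one] with i hi
    rw [norm_mul]
    calc ‖((N i / lam : ℝ) : ℂ)‖ * _ ≤ ‖((N i / lam : ℝ) : ℂ)‖ * ‖(lam : ℂ) * ℓ i‖ ^ 3 := by
          gcongr
          exact norm_exp_sub_quadratic_le hi
      _ = lam ^ 2 * ‖(Real.sqrt (N i) : ℂ) * ℓ i‖ ^ 2 * ‖ℓ i‖ := by
          have hN0 : (0 : ℝ) ≤ N i := Nat.cast_nonneg _
          rw [norm_mul, norm_mul, Complex.norm_real, Complex.norm_real, Complex.norm_real,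
            Real.norm_of_nonneg hlam.le, Real.norm_of_nonneg (Real.sqrt_nonneg _),
            Real.norm_of_nonneg (div_nonneg hN0 hlam.le), mul_pow _ _ 2, Real.sq_sqrt hN0]
          field_simp
  have := herr.add hmain
  rw [zero_add] at this
  refine this.congr fun i => ?_
  rw [mul_pow (Real.sqrt (N i) : ℂ), ← hsq]
  push_cast
  field_simp
  ring

theorem tendsto_normalizedGrowth {f : ℂ → ℂ} {a b : ℂ} {lam θ μ : ℝ} (hlam : 0 < lam)
    (hθ : 0 < θ) (hθπ : θ < Real.pi) (hgrowth : HasOneDirectionGrowth f a b lam θ μ)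
    {ι : Type*} {l : Filter ι} {N : ι → ℕ} {ℓ : ι → ℂ} {v : ℂ} (hN : Tendsto N l atTop)
    (hℓ : Tendsto (fun i => (Real.sqrt (N i) : ℂ) * ℓ i) l (𝓝 v)) :
    Tendsto (fun i => normalizedGrowth f a b lam (N i) (ℓ i)) l
      (𝓝 (Complex.exp (lam * v ^ 2 / 2))) := by
  obtain ⟨⟨δ, hδ, hf⟩, -⟩ := hgrowth
  have h0 := tendsto_zero_of_sqrt_mul_tendsto hN hℓ
  have hre : Tendsto (fun i => (ℓ i).re) l (𝓝 0) := by
    simpa [Function.comp_def] using (Complex.continuous_re.tendsto 0).comp h0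
  have him : ∀ᶠ i in l, |(ℓ i).im| ≤ θ := by
    have : Tendsto (fun i => |(ℓ i).im|) l (𝓝 0) := by
      simpa [Function.comp_def] using (Complex.continuous_im.abs.tendsto 0).comp h0
    exact this.eventually_le_const hθ
  have hsec := tendsto_scalingRadius_mul_exp_sector hlam hθπ hN hre him
  have hlog : Tendsto (fun i => Real.log (scalingRadius lam (N i))) l atTop :=
    (tendsto_log_scalingRadius hlam).comp hN
  have hquot : Tendsto (fun i => 1 + ℓ i / (Real.log (scalingRadius lam (N i)) : ℝ)) l
      (𝓝 1) := by
    have h1 : Tendsto (fun i => (((Real.log (scalingRadius lam (N i)))⁻¹ : ℝ) : ℂ)) l (𝓝 0) := by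
      have := (Complex.continuous_ofReal.tendsto 0).comp (tendsto_inv_atTop_zero.comp hlog)
      simpa [Function.comp_def] using this
    have h2 := (h0.mul h1).const_add 1
    simpa [div_eq_mul_inv] using h2
  have hcpow : Tendsto (fun i => (1 + ℓ i / (Real.log (scalingRadius lam (N i)) : ℝ)) ^ b) l
      (𝓝 1) := by
    have := (continuousAt_cpow_const (b := b) Complex.one_mem_slitPlane).tendsto.comp hquot
    simpa [Function.comp_def] using this
  have hexp : Tendsto (fun i => Complex.exp (a * ℓ i)) l (𝓝 1) := by
    have := (Complex.continuous_exp.tendsto _).comp (h0.const_mul a)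
    simpa [Function.comp_def] using this
  have hone : Tendsto (fun i => 1 + δ (scalingRadius lam (N i) * Complex.exp (ℓ i))) l (𝓝 1) := by
    simpa [Function.comp_def] using (hδ.comp hsec).const_add 1
  have hsaddle := (Complex.continuous_exp.tendsto _).comp (tendsto_saddle_exponent hlam hN hℓ)
  have hprod := ((hexp.mul hcpow).mul hsaddle).mul hone
  rw [one_mul, one_mul, mul_one] at hprod
  refine hprod.congr' ?_
  have hnorm : Tendsto (fun i => ‖ℓ i‖) l (𝓝 0) := by simpa using h0.norm
  filter_upwards [hsec.eventually hf, him, hnorm.eventually_lt_const zero_lt_one,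
    hlog.eventually_gt_atTop 1,
    ((tendsto_scalingRadius hlam).comp hN).eventually_gt_atTop 1] with i h1 h2 h3 h4 h5
  exact (normalizedGrowth_eq hlam h5 (h2.trans_lt hθπ) (h3.trans h4) h1).symm

/-! ### Uniform bounds for the growth on the whole circle -/

/-- For `ℓ = iφ` the exponent has real part `(n/λ)(cos λφ - 1)`, and the other factors stay bounded.
Working along `atTop ×ˢ 𝓟` makes the estimates uniform in `φ`. -/
theorem exists_norm_normalizedGrowth_le_of_abs_le {f : ℂ → ℂ} {a b : ℂ} {lam θ μ : ℝ}
    (hlam : 0 < lam) (hθπ : θ < Real.pi) (hgrowth : HasOneDirectionGrowth f a b lam θ μ) :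
    ∃ C : ℝ, 0 ≤ C ∧ ∀ᶠ n : ℕ in atTop, ∀ φ : ℝ, |φ| ≤ θ →
      ‖normalizedGrowth f a b lam n (φ * Complex.I)‖ ≤
        C * Real.exp (n / lam * (Real.cos (lam * φ) - 1)) := by
  obtain ⟨⟨δ, hδ, hf⟩, -⟩ := hgrowth
  -- The three factors bound `exp(aℓ)`, `(1 + ℓ/log r)^b` and `1 + δ`; the last two have norm
  -- tending to `1`.
  refine ⟨Real.exp (‖a‖ * Real.pi) * 2 * 2, by positivity, ?_⟩
  suffices h : ∀ᶠ p : ℕ × ℝ in atTop ×ˢ 𝓟 {φ : ℝ | |φ| ≤ θ},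
      ‖normalizedGrowth f a b lam p.1 (p.2 * Complex.I)‖ ≤
        Real.exp (‖a‖ * Real.pi) * 2 * 2 * Real.exp (p.1 / lam * (Real.cos (lam * p.2) - 1)) from
    eventually_prod_principal_iff.1 h
  set l : Filter (ℕ × ℝ) := atTop ×ˢ 𝓟 {φ : ℝ | |φ| ≤ θ}
  have hN : Tendsto (fun p : ℕ × ℝ => p.1) l atTop := tendsto_fst
  have hφ : ∀ᶠ p in l, |p.2| ≤ θ := tendsto_snd.eventually (mem_principal_self _)
  have hsec := tendsto_scalingRadius_mul_exp_sector hlam hθπ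
    (ℓ := fun p : ℕ × ℝ => p.2 * Complex.I) hN (by simpa using tendsto_const_nhds) (by simpa using hφ)
  have hlog : Tendsto (fun p : ℕ × ℝ => Real.log (scalingRadius lam p.1)) l atTop :=
    (tendsto_log_scalingRadius hlam).comp hN
  have hquot : Tendsto (fun p : ℕ × ℝ =>
      1 + p.2 * Complex.I / (Real.log (scalingRadius lam p.1) : ℝ)) l (𝓝 1) := by
    have h1 : Tendsto (fun p : ℕ × ℝ =>
        p.2 * Complex.I / (Real.log (scalingRadius lam p.1) : ℝ)) l (𝓝 0) := by
      refine squeeze_zero_norm' (a := fun p : ℕ × ℝ =>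
        θ * (Real.log (scalingRadius lam p.1))⁻¹) ?_ ?_
      · filter_upwards [hφ, hlog.eventually_gt_atTop 0] with p h1 h2
        rw [norm_div, norm_mul, Complex.norm_I, mul_one, Complex.norm_real, Complex.norm_real,
          Real.norm_eq_abs, Real.norm_of_nonneg h2.le, div_eq_mul_inv]
        gcongr
      · simpa [Function.comp_def] using (tendsto_inv_atTop_zero.comp hlog).const_mul θ
    simpa using h1.const_add 1
  have hcpow := (continuousAt_cpow_const (b := b) Complex.one_mem_slitPlane).norm.tendsto.comp hquot
  have hone := ((hδ.comp hsec).const_add 1).norm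
  simp only [Complex.one_cpow, norm_one, add_zero] at hcpow hone
  filter_upwards [hφ, hsec.eventually hf, hlog.eventually_gt_atTop θ,
    ((tendsto_scalingRadius hlam).comp hN).eventually_gt_atTop 1,
    hcpow.eventually_le_const one_lt_two, hone.eventually_le_const one_lt_two]
    with p h1 h2 h3 h4 h5 h6
  simp only [Function.comp_apply] at h4 h5 h6
  rw [normalizedGrowth_eq hlam h4 (by simpa using h1.trans_lt hθπ)
    (by simpa using h1.trans_lt h3) h2, norm_mul, norm_mul, norm_mul]
  have e1 : ‖Complex.exp (a * (p.2 * Complex.I))‖ ≤ Real.exp (‖a‖ * Real.pi) := by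
    refine (Complex.norm_exp_le_exp_norm _).trans (Real.exp_le_exp.2 ?_)
    rw [norm_mul, norm_mul, Complex.norm_I, mul_one, Complex.norm_real, Real.norm_eq_abs]
    gcongr
    exact h1.trans hθπ.le
  have e2 : ‖Complex.exp ((p.1 / lam : ℝ) * (Complex.exp (lam * (p.2 * Complex.I)) - 1) -
      p.1 * (p.2 * Complex.I))‖ = Real.exp (p.1 / lam * (Real.cos (lam * p.2) - 1)) := by
    rw [Complex.norm_exp, show (lam : ℂ) * (p.2 * Complex.I) = ((lam * p.2 : ℝ) : ℂ) * Complex.I by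
      push_cast; ring, Complex.sub_re, Complex.re_ofReal_mul, Complex.sub_re,
      Complex.exp_ofReal_mul_I_re]
    simp
  rw [e2]
  calc _ ≤ Real.exp (‖a‖ * Real.pi) * 2 * Real.exp (p.1 / lam * (Real.cos (lam * p.2) - 1)) * 2 := by
        gcongr
    _ = _ := by ring

/-- With `y = n/λ`, the quotient is a power of `y` times a power of `(log y)/λ` times `exp(-(1 -
μ)y)`, and the exponential wins since `μ < 1`. -/
theorem tendsto_exp_div_growthScale {a b : ℂ} {lam μ : ℝ} (hlam : 0 < lam) (hμ : μ < 1) :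
    Tendsto (fun n : ℕ => Real.exp (μ * (n / lam)) / ‖growthScale a b lam n‖) atTop (𝓝 0) := by
  have hy := tendsto_natCast_div_atTop hlam
  have key : Tendsto (fun y : ℝ => (y ^ (-a.re / lam) * (1 / lam * Real.log y) ^ (-b.re)) *
      Real.exp (-((1 - μ) * y))) atTop (𝓝 0) := by
    have h1 : (fun y : ℝ => (1 / lam * Real.log y) ^ (-b.re)) =o[atTop] fun y => y ^ (1 : ℝ) := by
      have : (fun y : ℝ => (1 / lam) ^ (-b.re) * Real.log y ^ (-b.re)) =o[atTop]
          fun y => y ^ (1 : ℝ) := (isLittleO_log_rpow_rpow_atTop _ one_pos).const_mul_left _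
      refine this.congr' ?_ EventuallyEq.rfl
      filter_upwards [eventually_ge_atTop 1] with y hy
      rw [Real.mul_rpow (by positivity) (Real.log_nonneg hy)]
    have h2 : (fun y : ℝ => y ^ (-a.re / lam) * (1 / lam * Real.log y) ^ (-b.re)) =o[atTop]
        fun y => y ^ (-a.re / lam + 1) := by
      refine ((isBigO_refl (fun y : ℝ => y ^ (-a.re / lam)) atTop).mul_isLittleO h1).congr'
        EventuallyEq.rfl ?_
      filter_upwards [eventually_gt_atTop 0] with y hy
      rw [Real.rpow_add hy]
    have h3 := h2.trans (isLittleO_rpow_exp_pos_mul_atTop (-a.re / lam + 1) (sub_pos.2 hμ))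
    refine h3.tendsto_div_nhds_zero.congr fun y => ?_
    rw [Real.exp_neg, div_eq_mul_inv]
  refine (key.comp hy).congr' ?_
  filter_upwards [(tendsto_scalingRadius hlam).eventually_gt_atTop 1,
    hy.eventually_gt_atTop 1] with n h1 h2
  have hlogr : Real.log (scalingRadius lam n) = 1 / lam * Real.log (n / lam) := by
    rw [scalingRadius, Real.log_rpow (by linarith)]
  have hL : 0 < 1 / lam * Real.log (n / lam) := mul_pos (by positivity) (Real.log_pos h2)
  rw [growthScale, norm_mul, norm_mul, Complex.norm_cpow_eq_rpow_re_of_pos (by linarith), hlogr,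
    Complex.norm_cpow_eq_rpow_re_of_pos hL, Complex.norm_exp, Complex.ofReal_re, scalingRadius,
    ← Real.rpow_mul (by linarith)]
  simp only [Function.comp_apply]
  rw [show -((1 - μ) * (n / lam)) = μ * (n / lam) - n / lam by ring, Real.exp_sub,
    show -a.re / lam = -(1 / lam * a.re) by ring, Real.rpow_neg (by linarith),
    Real.rpow_neg hL.le]
  field_simp

theorem exists_norm_normalizedGrowth_le_of_lt_abs {f : ℂ → ℂ} {a b : ℂ} {lam θ μ : ℝ}
    (hlam : 0 < lam) (hμ : μ < 1) (hgrowth : HasOneDirectionGrowth f a b lam θ μ) :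
    ∃ ε : ℕ → ℝ, Tendsto ε atTop (𝓝 0) ∧ ∀ᶠ n : ℕ in atTop, ∀ φ ∈ Set.Ioc (-Real.pi) Real.pi,
      θ < |φ| → ‖normalizedGrowth f a b lam n (φ * Complex.I)‖ ≤ ε n := by
  obtain ⟨-, hO⟩ := hgrowth
  obtain ⟨C, hC⟩ := hO.bound
  refine ⟨fun n => C * (Real.exp (μ * (n / lam)) / ‖growthScale a b lam n‖), ?_, ?_⟩
  · simpa using (tendsto_exp_div_growthScale hlam hμ).const_mul C
  set s : Set ℝ := {φ | φ ∈ Set.Ioc (-Real.pi) Real.pi ∧ θ < |φ|}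
  suffices h : ∀ᶠ p : ℕ × ℝ in atTop ×ˢ 𝓟 s,
      ‖normalizedGrowth f a b lam p.1 (p.2 * Complex.I)‖ ≤
        C * (Real.exp (μ * (p.1 / lam)) / ‖growthScale a b lam p.1‖) by
    filter_upwards [eventually_prod_principal_iff.1 h] with n hn φ h1 h2 using hn φ ⟨h1, h2⟩
  have hN : Tendsto (fun p : ℕ × ℝ => p.1) (atTop ×ˢ 𝓟 s) atTop := tendsto_fst
  have hs : ∀ᶠ p : ℕ × ℝ in atTop ×ˢ 𝓟 s, p.2 ∈ s :=
    tendsto_snd.eventually (mem_principal_self _)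
  have hr := ((tendsto_scalingRadius hlam).comp hN).eventually_gt_atTop 0
  have hsec : Tendsto (fun p : ℕ × ℝ => (scalingRadius lam p.1 : ℂ) *
      Complex.exp (p.2 * Complex.I)) (atTop ×ˢ 𝓟 s) (cosectorAtInfinity θ) := by
    refine tendsto_inf.2 ⟨tendsto_scalingRadius_mul_exp_cobounded hlam hN (by simpa using tendsto_const_nhds), ?_⟩
    rw [tendsto_principal]
    filter_upwards [hs, hr] with p hp h0
    simp only [Function.comp_apply] at h0
    rw [arg_ofReal_mul_exp h0 (by simpa using hp.1.1) (by simpa using hp.1.2)]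
    simpa using hp.2
  filter_upwards [hsec.eventually hC, hr] with p hp h0
  simp only [Function.comp_apply] at h0
  have hnorm : ‖(scalingRadius lam p.1 : ℂ) * Complex.exp (p.2 * Complex.I)‖ =
      scalingRadius lam p.1 := by
    rw [norm_mul, Complex.norm_exp_ofReal_mul_I, mul_one, Complex.norm_real,
      Real.norm_of_nonneg h0.le]
  rw [hnorm, scalingRadius_rpow hlam, Real.norm_of_nonneg (Real.exp_nonneg _)] at hp
  have he : ‖Complex.exp (-(p.1 * (p.2 * Complex.I)))‖ = 1 := by
    rw [Complex.norm_exp]; simp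
  rw [normalizedGrowth, norm_div, norm_mul, he, mul_one, mul_div_assoc']
  gcongr

/-! ### The complementary error function and the Gaussian Cauchy transform -/

theorem integrable_exp_neg_add_sq (z : ℂ) :
    Integrable fun t : ℝ => Complex.exp (-(z + (t : ℂ)) ^ 2) := by
  refine (integrable_cexp_quadratic (b := 1) (by simp) (-2 * z) (-z ^ 2)).congr ?_
  refine .of_forall fun t => ?_
  simp only
  ring_nf

/-- Under `t ↦ -t` the ray from `-z` becomes the left half of the horizontal line through `z`; the
Gaussian integral over the full line is `√π`. -/
theorem complexErfc_add_complexErfc_neg (z : ℂ) : complexErfc z + complexErfc (-z) = 2 := by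
  have hneg : ∫ t in Set.Ioi (0 : ℝ), Complex.exp (-(-z + (t : ℂ)) ^ 2) =
      ∫ t in Set.Iic (0 : ℝ), Complex.exp (-(z + (t : ℂ)) ^ 2) := by
    have := integral_comp_neg_Ioi (0 : ℝ) fun t : ℝ => Complex.exp (-(z + (t : ℂ)) ^ 2)
    rw [neg_zero] at this
    rw [← this]
    refine integral_congr_ae (.of_forall fun t => ?_)
    simp only [Complex.ofReal_neg]
    ring_nf
  have htot : ∫ t : ℝ, Complex.exp (-(z + (t : ℂ)) ^ 2) = (Real.sqrt Real.pi : ℂ) := by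
    have := integral_cexp_quadratic (b := -1) (by simp) (-2 * z) (-z ^ 2)
    rw [show -z ^ 2 - (-2 * z) ^ 2 / (4 * -1) = 0 by ring, Complex.exp_zero, mul_one, neg_neg,
      div_one] at this
    rw [Real.sqrt_eq_rpow, Complex.ofReal_cpow Real.pi_pos.le]
    push_cast
    rw [← this]
    refine integral_congr_ae (.of_forall fun t => ?_)
    simp only
    ring_nf
  have hi := integrable_exp_neg_add_sq z
  have hpi : (Real.sqrt Real.pi : ℂ) ≠ 0 := by
    exact_mod_cast (Real.sqrt_pos.2 Real.pi_pos).ne'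
  rw [complexErfc, complexErfc, ← mul_add, hneg, add_comm,
    intervalIntegral.integral_Iic_add_Ioi hi.integrableOn hi.integrableOn, htot]
  field_simp

theorem continuous_complexErfc : Continuous complexErfc := by
  refine continuous_const.mul (continuous_iff_continuousAt.2 fun z₀ => ?_)
  refine continuousAt_of_dominated (bound := fun t : ℝ =>
    Real.exp (2 * (‖z₀‖ + 1) ^ 2) * Real.exp (-(1 / 2) * t ^ 2)) ?_ ?_ ?_ ?_
  · exact .of_forall fun z => (by fun_prop : Continuous _).aestronglyMeasurable
  · filter_upwards [Metric.ball_mem_nhds z₀ one_pos] with z hz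
    refine .of_forall fun t => ?_
    rw [← Real.exp_add, Complex.norm_exp]
    refine Real.exp_le_exp.2 ?_
    have hz' : ‖z‖ ≤ ‖z₀‖ + 1 := by
      have := norm_sub_norm_le z z₀
      rw [mem_ball_iff_norm] at hz
      linarith
    have h1 : ‖z‖ ^ 2 = z.re ^ 2 + z.im ^ 2 := by
      rw [Complex.sq_norm, Complex.normSq_apply]; ring
    have h2 : ‖z‖ ^ 2 ≤ (‖z₀‖ + 1) ^ 2 := by gcongr
    have h3 : (-(z + (t : ℂ)) ^ 2).re = z.im ^ 2 - (z.re + t) ^ 2 := by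
      simp [pow_two]
    rw [h3]
    nlinarith [sq_nonneg (2 * z.re + t), sq_nonneg z.im]
  · exact ((integrable_exp_neg_mul_sq (by norm_num : (0 : ℝ) < 1 / 2)).const_mul _).integrableOn
  · exact .of_forall fun t => by fun_prop

theorem integral_gaussian_mul_exp {lam : ℝ} (hlam : 0 < lam) (s : ℝ) :
    ∫ t : ℝ, Complex.exp (-(lam * t ^ 2 / 2)) * Complex.exp (-(s * (t * Complex.I))) =
      (Real.sqrt (2 * Real.pi / lam) : ℂ) * Complex.exp (-(s ^ 2 / (2 * lam))) := by
  have hlamC : (lam : ℂ) ≠ 0 := by exact_mod_cast hlam.ne'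
  have h := integral_cexp_quadratic (b := -(lam / 2)) (by simpa using hlam) (-(s * Complex.I)) 0
  have h1 : (Real.pi / -(-(lam / 2)) : ℂ) = ((2 * Real.pi / lam : ℝ) : ℂ) := by
    push_cast; field_simp
  have h2 : (0 - (-(s * Complex.I)) ^ 2 / (4 * -(lam / 2)) : ℂ) = -(s ^ 2 / (2 * lam)) := by
    rw [neg_sq, mul_pow, Complex.I_sq]; field_simp; ring
  rw [h1, h2] at h
  rw [Real.sqrt_eq_rpow, Complex.ofReal_cpow (by positivity)]
  push_cast at h ⊢
  rw [← h]
  refine integral_congr_ae (.of_forall fun t => ?_)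
  simp only [← Complex.exp_add]
  ring_nf

/-- The Gaussian Cauchy transform in the left half-plane. -/
theorem integral_gaussian_div_sub {lam : ℝ} (hlam : 0 < lam) {w : ℂ} (hw : w.re < 0) :
    ∫ t : ℝ, Complex.exp (-(lam * t ^ 2 / 2)) / (t * Complex.I - w) =
      Real.pi * Complex.exp (lam * w ^ 2 / 2) *
        complexErfc (-(w * (Real.sqrt (lam / 2) : ℂ))) := by
  have hlamC : (lam : ℂ) ≠ 0 := by exact_mod_cast hlam.ne'
  -- As `Re w < 0`, the kernel is a Laplace integral. Fubini then leaves a Gaussian Fourier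
  -- transform in `t`.
  have hlaplace : ∀ t : ℝ, ∫ s in Set.Ioi (0 : ℝ),
      Complex.exp ((w - t * Complex.I) * s) = 1 / (t * Complex.I - w) := by
    intro t
    rw [integral_exp_mul_complex_Ioi (by simpa using hw)]
    simp only [Complex.ofReal_zero, mul_zero, Complex.exp_zero]
    rw [← neg_sub (t * Complex.I) w, neg_div_neg_eq]
  have hint : Integrable (Function.uncurry fun (t s : ℝ) =>
      Complex.exp (-(lam * t ^ 2 / 2)) * Complex.exp ((w - t * Complex.I) * s))
      (volume.prod (volume.restrict (Set.Ioi (0 : ℝ)))) := by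
    have h1 : Integrable fun t : ℝ => Real.exp (-(lam / 2) * t ^ 2) :=
      integrable_exp_neg_mul_sq (by positivity)
    have h2 : Integrable (fun s : ℝ => Real.exp (w.re * s))
        (volume.restrict (Set.Ioi (0 : ℝ))) := integrableOn_exp_mul_Ioi hw 0
    refine (h1.mul_prod h2).mono' (Continuous.aestronglyMeasurable (by fun_prop)) ?_
    refine .of_forall fun p => le_of_eq ?_
    simp only [Function.uncurry, norm_mul, Complex.norm_exp]
    congr 2
    · rw [show (-(lam * p.1 ^ 2 / 2) : ℂ) = ((-(lam / 2) * p.1 ^ 2 : ℝ) : ℂ) by push_cast; ring,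
        Complex.ofReal_re]
    · simp
  have hswap : ∫ t : ℝ, Complex.exp (-(lam * t ^ 2 / 2)) / (t * Complex.I - w) =
      ∫ s in Set.Ioi (0 : ℝ), Complex.exp (w * s) *
        ((Real.sqrt (2 * Real.pi / lam) : ℂ) * Complex.exp (-(s ^ 2 / (2 * lam)))) := by
    calc _ = ∫ t : ℝ, ∫ s in Set.Ioi (0 : ℝ),
          Complex.exp (-(lam * t ^ 2 / 2)) * Complex.exp ((w - t * Complex.I) * s) := by
          refine integral_congr_ae (.of_forall fun t => ?_)
          simp only
          rw [integral_const_mul, hlaplace, mul_one_div]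
      _ = ∫ s in Set.Ioi (0 : ℝ), ∫ t : ℝ,
          Complex.exp (-(lam * t ^ 2 / 2)) * Complex.exp ((w - t * Complex.I) * s) :=
          integral_integral_swap hint
      _ = _ := by
          refine integral_congr_ae (.of_forall fun s => ?_)
          simp only
          rw [← integral_gaussian_mul_exp hlam, ← integral_const_mul]
          refine integral_congr_ae (.of_forall fun t => ?_)
          simp only
          rw [show (w - t * Complex.I) * s = w * s + -(s * (t * Complex.I)) by ring,
            Complex.exp_add]
          ring
  have hc : 0 < Real.sqrt (2 * lam) := Real.sqrt_pos.2 (by positivity)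
  have hcsq : ((Real.sqrt (2 * lam) : ℝ) : ℂ) ^ 2 = 2 * lam := by
    rw [← Complex.ofReal_pow, Real.sq_sqrt (by positivity)]; push_cast; ring
  have hcd : ((Real.sqrt (2 * lam) : ℝ) : ℂ) = 2 * (Real.sqrt (lam / 2) : ℂ) := by
    rw [show 2 * lam = 2 ^ 2 * (lam / 2) by ring, Real.sqrt_mul (by norm_num),
      Real.sqrt_sq (by norm_num)]
    push_cast; rfl
  have hdsq : ((Real.sqrt (lam / 2) : ℝ) : ℂ) ^ 2 = lam / 2 := by
    rw [← Complex.ofReal_pow, Real.sq_sqrt (by positivity)]; push_cast; ring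
  have hcoef : ((Real.sqrt (2 * lam) : ℝ) : ℂ) * (Real.sqrt (2 * Real.pi / lam) : ℂ) =
      Real.pi * (2 / (Real.sqrt Real.pi : ℂ)) := by
    have : Real.sqrt (2 * lam) * Real.sqrt (2 * Real.pi / lam) =
        Real.pi * (2 / Real.sqrt Real.pi) := by
      rw [← Real.sqrt_mul (by positivity), show 2 * lam * (2 * Real.pi / lam) = 2 ^ 2 * Real.pi by
        field_simp, Real.sqrt_mul (by norm_num), Real.sqrt_sq (by norm_num)]
      have := Real.sqrt_pos.2 Real.pi_pos
      field_simp
      rw [Real.sq_sqrt Real.pi_pos.le]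
    exact_mod_cast this
  rw [hswap]
  -- Substituting `s = √(2λ) x` turns `ws - s²/(2λ)` into `λw²/2 - (x - w√(λ/2))²`.
  have hsc := integral_comp_mul_left_Ioi (fun s : ℝ => Complex.exp (w * s) *
    ((Real.sqrt (2 * Real.pi / lam) : ℂ) * Complex.exp (-(s ^ 2 / (2 * lam))))) 0 hc
  rw [mul_zero, eq_inv_smul_iff₀ hc.ne'] at hsc
  rw [← hsc, complexErfc, Complex.real_smul, ← integral_const_mul, ← integral_const_mul,
    ← integral_const_mul]
  refine integral_congr_ae (.of_forall fun x => ?_)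
  simp only
  push_cast
  have he : Complex.exp (w * (Real.sqrt (2 * lam) * x)) *
      Complex.exp (-((Real.sqrt (2 * lam) * x) ^ 2 / (2 * lam))) =
      Complex.exp (lam * w ^ 2 / 2) *
        Complex.exp (-(-(w * (Real.sqrt (lam / 2) : ℂ)) + x) ^ 2) := by
    rw [← Complex.exp_add, ← Complex.exp_add]
    congr 1
    rw [mul_pow, hcsq, hcd]
    field_simp
    linear_combination (2 * w ^ 2) * hdsq
  linear_combination (Complex.exp (w * (Real.sqrt (2 * lam) * x)) *
      Complex.exp (-((Real.sqrt (2 * lam) * x) ^ 2 / (2 * lam)))) * hcoef +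
      Real.pi * (2 / (Real.sqrt Real.pi : ℂ)) * he

/-! ### Displacements of order `1/√n` -/

/-- A map tangent to the identity at `0` does not change limits on the `1/√n` scale. It serves for
`exp x - 1` in the kernel and for `log (1 + x)` at the evaluation point. -/
theorem tendsto_sqrt_mul_comp_of_hasDerivAt {ι : Type*} {l : Filter ι} {N : ι → ℕ} {ℓ : ι → ℂ}
    {v : ℂ} {g : ℂ → ℂ} (hg : HasDerivAt g 1 0) (hg0 : g 0 = 0) (hN : Tendsto N l atTop)
    (hℓ : Tendsto (fun i => (Real.sqrt (N i) : ℂ) * ℓ i) l (𝓝 v)) :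
    Tendsto (fun i => (Real.sqrt (N i) : ℂ) * g (ℓ i)) l (𝓝 v) := by
  have h0 := tendsto_zero_of_sqrt_mul_tendsto hN hℓ
  have h1 : (fun x => g x - x) =o[𝓝 0] fun x : ℂ => x := by
    simpa [hg0] using hg.isLittleO
  have h2 := (isBigO_refl (fun i => (Real.sqrt (N i) : ℂ)) l).mul_isLittleO (h1.comp_tendsto h0)
  have h3 := (h2.trans_isBigO (hℓ.isBigO_one ℂ)).tendsto_div_nhds_zero.add hℓ
  rw [zero_add] at h3
  refine h3.congr fun i => ?_
  simp only [Function.comp_apply, div_one]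
  ring

theorem exists_norm_one_add_div_sqrt_le {w₀ : ℂ} (hw₀ : w₀.re < 0) :
    ∃ c : ℝ, 0 < c ∧ ∀ᶠ p : ℕ × ℂ in atTop ×ˢ 𝓝 w₀,
      ‖1 + p.2 / (Real.sqrt p.1 : ℂ)‖ ≤ 1 - c / Real.sqrt p.1 := by
  -- Near `w₀`, `Re w ≤ -2c`, so the squared norm is at most `1 - 4c/√n + ‖w‖²/n`. For large `n` the
  -- last term is at most `2c/√n`, and `1 - 2c/√n ≤ (1 - c/√n)²`.
  set c : ℝ := -w₀.re / 4 with hc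
  have hc0 : 0 < c := by linarith
  refine ⟨c, hc0, ?_⟩
  have hN : Tendsto (fun p : ℕ × ℂ => p.1) (atTop ×ˢ 𝓝 w₀) atTop := tendsto_fst
  have hw : Tendsto (fun p : ℕ × ℂ => p.2) (atTop ×ˢ 𝓝 w₀) (𝓝 w₀) := tendsto_snd
  have hs := tendsto_sqrt_natCast hN
  have hre := (Complex.continuous_re.tendsto w₀).comp hw
  set B := ‖w₀‖ + 1
  filter_upwards [hs.eventually_gt_atTop 0, hs.eventually_ge_atTop c,
    hs.eventually_ge_atTop (B ^ 2 / (2 * c)),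
    hw.norm.eventually_le_const (lt_add_one ‖w₀‖),
    hre.eventually_le_const (by linarith : w₀.re < w₀.re / 2)] with p h1 h2 h3 h4 h5
  simp only [Function.comp_apply] at h5
  generalize Real.sqrt p.1 = s at *
  have hcs : c / s ≤ 1 := (div_le_one h1).2 h2
  refine le_of_sq_le_sq ?_ (by linarith)
  have e1 : ‖1 + p.2 / (s : ℂ)‖ ^ 2 = 1 + 2 * p.2.re / s + ‖p.2‖ ^ 2 / s ^ 2 := by
    rw [Complex.sq_norm, Complex.sq_norm, Complex.normSq_apply, Complex.normSq_apply]
    simp only [Complex.add_re, Complex.one_re, Complex.div_ofReal_re, Complex.add_im,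
      Complex.one_im, Complex.div_ofReal_im]
    field_simp
    ring
  have e2 : 2 * p.2.re / s ≤ -(4 * c) / s := by
    gcongr
    linarith
  have e3 : ‖p.2‖ ^ 2 / s ^ 2 ≤ 2 * c / s := by
    rw [div_le_iff₀ (by positivity)] at h3
    rw [div_le_div_iff₀ (by positivity) h1]
    have : ‖p.2‖ ^ 2 ≤ B ^ 2 := by gcongr
    nlinarith
  rw [e1]
  have e4 : (1 - c / s) ^ 2 = 1 - 2 * c / s + (c / s) ^ 2 := by ring
  have e5 : -(4 * c) / s + 2 * c / s = - (2 * c / s) := by ring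
  nlinarith [sq_nonneg (c / s)]

/-! ### Limit of the remainder integral -/

noncomputable section

/-- The integrand of the normalised remainder, as a function of the angle. -/
def remainderIntegrand (f : ℂ → ℂ) (a b : ℂ) (lam : ℝ) (n : ℕ) (w : ℂ) (φ : ℝ) : ℂ :=
  normalizedGrowth f a b lam n (φ * Complex.I) *
    (Complex.exp (φ * Complex.I) /
      (Complex.exp (φ * Complex.I) - (1 + w / (Real.sqrt n : ℂ))))

end

/-- Only measurability is available for every `w`: the denominator may vanish when `1 + w/√n` lies
on the unit circle. -/
theorem measurable_remainderIntegrand {f : ℂ → ℂ} (hf : Continuous f) (a b : ℂ) (lam : ℝ)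
    (n : ℕ) (w : ℂ) : Measurable (remainderIntegrand f a b lam n w) := by
  have h1 : Measurable fun φ : ℝ => normalizedGrowth f a b lam n (φ * Complex.I) := by
    unfold normalizedGrowth
    exact (Continuous.measurable (by fun_prop)).div_const _
  exact h1.mul ((Continuous.measurable (by fun_prop)).div (Continuous.measurable (by fun_prop)))

theorem norm_exp_mul_I_sub_ge (φ : ℝ) (q : ℂ) : 1 - ‖q‖ ≤ ‖Complex.exp (φ * Complex.I) - q‖ := by
  have := norm_sub_norm_le (Complex.exp (φ * Complex.I)) q
  rwa [Complex.norm_exp_ofReal_mul_I] at this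

/-- Dominated convergence after `φ = t/√n`. The kernel is at most `√n/c`, which the Jacobian `1/√n`
absorbs, and the growth has a Gaussian majorant as long as `λ|φ| ≤ π`. -/
theorem tendsto_integral_remainderIntegrand_near {f : ℂ → ℂ} {a b : ℂ} {lam θ μ : ℝ}
    (hlam : 0 < lam) (hθ : 0 < θ) (hθπ : θ < Real.pi)
    (hgrowth : HasOneDirectionGrowth f a b lam θ μ) (hf : Continuous f) {w₀ : ℂ}
    (hw₀ : w₀.re < 0) {φ₀ : ℝ} (h0 : 0 < φ₀) (h1 : φ₀ ≤ θ) (h2 : lam * φ₀ ≤ Real.pi) :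
    Tendsto (fun p : ℕ × ℂ => ∫ φ in Set.Icc (-φ₀) φ₀, remainderIntegrand f a b lam p.1 p.2 φ)
      (atTop ×ˢ 𝓝 w₀)
      (𝓝 (∫ t : ℝ, Complex.exp (-(lam * t ^ 2 / 2)) / (t * Complex.I - w₀))) := by
  have hN : Tendsto (fun p : ℕ × ℂ => p.1) (atTop ×ˢ 𝓝 w₀) atTop := tendsto_fst
  have hw : Tendsto (fun p : ℕ × ℂ => p.2) (atTop ×ˢ 𝓝 w₀) (𝓝 w₀) := tendsto_snd
  have hs := tendsto_sqrt_natCast hN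
  obtain ⟨c, hc, hq⟩ := exists_norm_one_add_div_sqrt_le hw₀
  obtain ⟨C, hC0, hC⟩ := exists_norm_normalizedGrowth_le_of_abs_le hlam hθπ hgrowth
  have hscale : ∀ᶠ p : ℕ × ℂ in atTop ×ˢ 𝓝 w₀,
      ∫ t : ℝ, ((Real.sqrt p.1)⁻¹ : ℂ) * (Set.Icc (-φ₀) φ₀).indicator
        (remainderIntegrand f a b lam p.1 p.2) (t / Real.sqrt p.1) =
      ∫ φ in Set.Icc (-φ₀) φ₀, remainderIntegrand f a b lam p.1 p.2 φ := by
    filter_upwards [hs.eventually_gt_atTop 0] with p hp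
    have hpC : (Real.sqrt p.1 : ℂ) ≠ 0 := by exact_mod_cast hp.ne'
    rw [integral_const_mul, Measure.integral_comp_div, abs_of_pos hp, Complex.real_smul,
      inv_mul_cancel_left₀ hpC, integral_indicator measurableSet_Icc]
  refine Tendsto.congr' hscale ?_
  refine tendsto_integral_filter_of_dominated_convergence
    (fun t => C * Real.exp (-(2 * lam / Real.pi ^ 2) * t ^ 2) / c) ?_ ?_ ?_ ?_
  · refine .of_forall fun p => Measurable.aestronglyMeasurable ?_
    exact (((measurable_remainderIntegrand hf a b lam p.1 p.2).indicator measurableSet_Icc).comp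
      (measurable_id.div_const _)).const_mul _
  · filter_upwards [hN.eventually hC, hq, hs.eventually_gt_atTop 0] with p hCp hqp hp
    refine .of_forall fun t => ?_
    by_cases ht : t / Real.sqrt p.1 ∈ Set.Icc (-φ₀) φ₀
    · rw [Set.indicator_of_mem ht, remainderIntegrand]
      have habs := abs_le.2 ht
      have hng := hCp _ (habs.trans h1)
      -- From `cos x ≤ 1 - 2x²/π²` on `|x| ≤ π`; the factor `n` cancels the `1/n` of the rescaled
      -- square.
      have hcos : (p.1 : ℝ) / lam * (Real.cos (lam * (t / Real.sqrt p.1)) - 1) ≤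
          -(2 * lam / Real.pi ^ 2) * t ^ 2 := by
        have := Real.cos_le_one_sub_mul_cos_sq (x := lam * (t / Real.sqrt p.1)) (by
          rw [abs_mul, abs_of_pos hlam]
          exact (mul_le_mul_of_nonneg_left habs hlam.le).trans h2)
        have hp1 : (p.1 : ℝ) = Real.sqrt p.1 ^ 2 := (Real.sq_sqrt (Nat.cast_nonneg _)).symm
        calc (p.1 : ℝ) / lam * (Real.cos (lam * (t / Real.sqrt p.1)) - 1) ≤
            (p.1 : ℝ) / lam * (-(2 / Real.pi ^ 2 * (lam * (t / Real.sqrt p.1)) ^ 2)) := by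
              gcongr
              linarith
          _ = _ := by
              rw [hp1]
              simp only [Real.sqrt_sq hp.le]
              field_simp
      have hden : c / Real.sqrt p.1 ≤ ‖Complex.exp ((t / Real.sqrt p.1 : ℝ) * Complex.I) -
          (1 + p.2 / (Real.sqrt p.1 : ℂ))‖ := by
        linarith [norm_exp_mul_I_sub_ge (t / Real.sqrt p.1) (1 + p.2 / (Real.sqrt p.1 : ℂ))]
      rw [norm_mul, norm_mul, norm_div, Complex.norm_exp_ofReal_mul_I, norm_inv, Complex.norm_real,
        Real.norm_of_nonneg hp.le]
      calc _ ≤ (Real.sqrt p.1)⁻¹ * (C * Real.exp (-(2 * lam / Real.pi ^ 2) * t ^ 2) *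
            (1 / (c / Real.sqrt p.1))) := by
            gcongr
            exact hng.trans (by gcongr)
        _ = _ := by field_simp
    · rw [Set.indicator_of_notMem ht]
      simp only [mul_zero, norm_zero]
      positivity
  · exact ((integrable_exp_neg_mul_sq (by positivity)).const_mul C).div_const c
  · refine .of_forall fun t => ?_
    have hℓ : Tendsto (fun p : ℕ × ℂ => (Real.sqrt p.1 : ℂ) *
        ((t / Real.sqrt p.1 : ℝ) * Complex.I)) (atTop ×ˢ 𝓝 w₀) (𝓝 (t * Complex.I)) := by
      refine tendsto_const_nhds.congr' ?_
      filter_upwards [hs.eventually_gt_atTop 0] with p hp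
      have hpC : (Real.sqrt p.1 : ℂ) ≠ 0 := by exact_mod_cast hp.ne'
      push_cast
      field_simp
    have hng := tendsto_normalizedGrowth hlam hθ hθπ hgrowth hN hℓ
    have hsub := tendsto_sqrt_mul_comp_of_hasDerivAt (g := fun x => Complex.exp x - 1)
      (by simpa using (Complex.hasDerivAt_exp 0).sub_const 1) (by simp) hN hℓ
    have hexp : Tendsto (fun p : ℕ × ℂ => Complex.exp ((t / Real.sqrt p.1 : ℝ) * Complex.I))
        (atTop ×ˢ 𝓝 w₀) (𝓝 1) := by
      simpa [Function.comp_def] using (Complex.continuous_exp.tendsto 0).comp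
        (tendsto_zero_of_sqrt_mul_tendsto hN hℓ)
    have hne : t * Complex.I - w₀ ≠ 0 := by
      intro h
      have := congrArg Complex.re h
      simp at this
      exact hw₀.ne this
    have hlim := hng.mul (hexp.div (hsub.sub hw) hne)
    rw [mul_one_div, mul_pow, Complex.I_sq, show (lam * (t ^ 2 * -1) / 2 : ℂ) =
      -(lam * t ^ 2 / 2) by ring] at hlim
    refine hlim.congr' ?_
    have hsmall : Tendsto (fun p : ℕ × ℂ => |t / Real.sqrt p.1|) (atTop ×ˢ 𝓝 w₀) (𝓝 0) := by
      simpa using (hs.const_div_atTop t).abs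
    filter_upwards [hs.eventually_gt_atTop 0, hsmall.eventually_le_const h0] with p hp hsm
    have hpC : (Real.sqrt p.1 : ℂ) ≠ 0 := by exact_mod_cast hp.ne'
    have hmem : t / Real.sqrt p.1 ∈ Set.Icc (-φ₀) φ₀ := abs_le.1 hsm
    rw [Set.indicator_of_mem hmem, remainderIntegrand, mul_left_comm]
    congr 1
    rw [Pi.div_apply, ← div_eq_inv_mul, div_div]
    congr 1
    field_simp
    ring

/-- The chord has length `2|sin(φ/2)|`, and Jordan's inequality bounds the sine below. -/
theorem norm_exp_mul_I_sub_one_ge {φ : ℝ} (hφ : |φ| ≤ Real.pi) :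
    2 / Real.pi * |φ| ≤ ‖Complex.exp (φ * Complex.I) - 1‖ := by
  have h := Real.mul_abs_le_abs_sin (x := φ / 2) (by
    rw [abs_div, abs_two]; linarith)
  rw [mul_comm (φ : ℂ), Complex.norm_exp_I_mul_ofReal_sub_one, norm_mul, Real.norm_eq_abs, Real.norm_eq_abs,
    abs_two]
  rw [abs_div, abs_two] at h
  linarith

theorem ae_cos_const_mul_ne_one {lam : ℝ} (hlam : 0 < lam) :
    ∀ᵐ φ : ℝ, Real.cos (lam * φ) ≠ 1 := by
  have hc : (Set.range fun k : ℤ => (k : ℝ) * (2 * Real.pi) / lam).Countable :=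
    Set.countable_range _
  filter_upwards [hc.ae_notMem volume] with φ hφ h
  obtain ⟨k, hk⟩ := (Real.cos_eq_one_iff _).1 h
  exact hφ ⟨k, by simp only [hk]; field_simp⟩

/-- Away from `φ = 0` the kernel is bounded by `π/φ₀`. If `λθ ≥ 2π`, the bound inside the sector
does not decay at the points with `cos λφ = 1`. These are countable, so dominated convergence with a
constant majorant still gives zero. -/
theorem tendsto_integral_remainderIntegrand_far {f : ℂ → ℂ} {a b : ℂ} {lam θ μ : ℝ}
    (hlam : 0 < lam) (hθπ : θ < Real.pi) (hμ : μ < 1)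
    (hgrowth : HasOneDirectionGrowth f a b lam θ μ) (hf : Continuous f) (w₀ : ℂ)
    {φ₀ : ℝ} (h0 : 0 < φ₀) :
    Tendsto (fun p : ℕ × ℂ => ∫ φ in Set.Ioc (-Real.pi) Real.pi \ Set.Icc (-φ₀) φ₀,
      remainderIntegrand f a b lam p.1 p.2 φ) (atTop ×ˢ 𝓝 w₀) (𝓝 0) := by
  have hN : Tendsto (fun p : ℕ × ℂ => p.1) (atTop ×ˢ 𝓝 w₀) atTop := tendsto_fst
  have hw : Tendsto (fun p : ℕ × ℂ => p.2) (atTop ×ˢ 𝓝 w₀) (𝓝 w₀) := tendsto_snd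
  have hs := tendsto_sqrt_natCast hN
  obtain ⟨C, hC0, hC⟩ := exists_norm_normalizedGrowth_le_of_abs_le hlam hθπ hgrowth
  obtain ⟨ε, hε, hεb⟩ := exists_norm_normalizedGrowth_le_of_lt_abs hlam hμ hgrowth
  have hmeas : MeasurableSet (Set.Ioc (-Real.pi) Real.pi \ Set.Icc (-φ₀) φ₀) :=
    measurableSet_Ioc.diff measurableSet_Icc
  have hquot : Tendsto (fun p : ℕ × ℂ => ‖p.2 / (Real.sqrt p.1 : ℂ)‖) (atTop ×ˢ 𝓝 w₀) (𝓝 0) := by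
    refine (hw.norm.div_atTop hs).congr fun p => ?_
    rw [norm_div, Complex.norm_real, Real.norm_of_nonneg (Real.sqrt_nonneg _)]
  have hker : ∀ᶠ p : ℕ × ℂ in atTop ×ˢ 𝓝 w₀,
      ∀ φ ∈ Set.Ioc (-Real.pi) Real.pi \ Set.Icc (-φ₀) φ₀,
        ‖remainderIntegrand f a b lam p.1 p.2 φ‖ ≤
          ‖normalizedGrowth f a b lam p.1 (φ * Complex.I)‖ * (Real.pi / φ₀) := by
    filter_upwards [hquot.eventually_le_const (by positivity : 0 < φ₀ / Real.pi)] with p hp φ hφ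
    have hlow : φ₀ < |φ| := by
      by_contra! h
      exact hφ.2 (abs_le.1 h)
    have h3 := norm_exp_mul_I_sub_one_ge (abs_le.2 ⟨hφ.1.1.le, hφ.1.2⟩)
    have h4 := norm_sub_norm_le (Complex.exp (φ * Complex.I) - 1) (p.2 / (Real.sqrt p.1 : ℂ))
    have h5 : 2 / Real.pi * φ₀ ≤ 2 / Real.pi * |φ| := by gcongr
    have h6 : φ₀ / Real.pi ≤ ‖Complex.exp (φ * Complex.I) - (1 + p.2 / (Real.sqrt p.1 : ℂ))‖ := by
      rw [← sub_sub]
      have : 2 / Real.pi * φ₀ = 2 * (φ₀ / Real.pi) := by ring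
      linarith
    rw [remainderIntegrand, norm_mul, norm_div, Complex.norm_exp_ofReal_mul_I]
    rw [← one_div_div φ₀ Real.pi]
    gcongr
  rw [← integral_zero ℝ ℂ (μ := volume.restrict
    (Set.Ioc (-Real.pi) Real.pi \ Set.Icc (-φ₀) φ₀))]
  refine tendsto_integral_filter_of_dominated_convergence
    (fun _ => (C + 1) * (Real.pi / φ₀)) ?_ ?_ ?_ ?_
  · exact .of_forall fun p =>
      (measurable_remainderIntegrand hf a b lam p.1 p.2).aestronglyMeasurable
  · filter_upwards [hker, hN.eventually hC, hN.eventually hεb,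
      (hε.comp hN).eventually_le_const zero_lt_one] with p h1 h2 h3 h4
    filter_upwards [ae_restrict_mem hmeas] with φ hφ
    refine (h1 φ hφ).trans ?_
    gcongr
    rcases le_or_gt |φ| θ with h | h
    · refine (h2 φ h).trans ?_
      have : Real.exp (p.1 / lam * (Real.cos (lam * φ) - 1)) ≤ 1 := by
        rw [Real.exp_le_one_iff]
        exact mul_nonpos_of_nonneg_of_nonpos (by positivity) (by linarith [Real.cos_le_one (lam * φ)])
      nlinarith
    · exact (h3 φ hφ.1 h).trans (by simp only [Function.comp_apply] at h4; linarith)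
  · have : IsFiniteMeasure (volume.restrict
        (Set.Ioc (-Real.pi) Real.pi \ Set.Icc (-φ₀) φ₀)) :=
      ⟨by
        rw [Measure.restrict_apply_univ]
        exact (measure_mono Set.sdiff_subset).trans_lt measure_Ioc_lt_top⟩
    exact integrable_const _
  · filter_upwards [ae_restrict_mem hmeas, ae_restrict_of_ae (ae_cos_const_mul_ne_one hlam)]
      with φ hφ hcos
    rcases le_or_gt |φ| θ with h | h
    · refine squeeze_zero_norm' (a := fun p : ℕ × ℂ =>
        C * Real.exp (p.1 / lam * (Real.cos (lam * φ) - 1)) * (Real.pi / φ₀)) ?_ ?_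
      · filter_upwards [hker, hN.eventually hC] with p h1 h2
        exact (h1 φ hφ).trans (by gcongr; exact h2 φ h)
      · have hneg : Real.cos (lam * φ) - 1 < 0 :=
          sub_neg.2 (lt_of_le_of_ne (Real.cos_le_one _) hcos)
        have := Real.tendsto_exp_atBot.comp
          (((tendsto_natCast_div_atTop hlam).comp hN).atTop_mul_const_of_neg hneg)
        simpa [Function.comp_def] using (this.const_mul C).mul_const (Real.pi / φ₀)
    · refine squeeze_zero_norm' (a := fun p : ℕ × ℂ => ε p.1 * (Real.pi / φ₀)) ?_ ?_
      · filter_upwards [hker, hN.eventually hεb] with p h1 h2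
        exact (h1 φ hφ).trans (by gcongr; exact h2 φ hφ.1 h)
      · simpa [Function.comp_def] using (hε.comp hN).mul_const (Real.pi / φ₀)

theorem tendsto_integral_remainderIntegrand {f : ℂ → ℂ} {a b : ℂ} {lam θ μ : ℝ}
    (hlam : 0 < lam) (hθ : 0 < θ) (hθπ : θ < Real.pi) (hμ : μ < 1)
    (hgrowth : HasOneDirectionGrowth f a b lam θ μ) (hf : Continuous f) {w₀ : ℂ}
    (hw₀ : w₀.re < 0) :
    Tendsto (fun p : ℕ × ℂ => ∫ φ in (-Real.pi)..Real.pi, remainderIntegrand f a b lam p.1 p.2 φ)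
      (atTop ×ˢ 𝓝 w₀)
      (𝓝 (∫ t : ℝ, Complex.exp (-(lam * t ^ 2 / 2)) / (t * Complex.I - w₀))) := by
  -- The cut-off angle must lie in the sector of the asymptotic formula and in the range `λφ ≤ π` of
  -- the cosine bound.
  have h0 : 0 < min θ (Real.pi / lam) := lt_min hθ (by positivity)
  have h1 : min θ (Real.pi / lam) ≤ θ := min_le_left _ _
  have h2 : lam * min θ (Real.pi / lam) ≤ Real.pi := by
    rw [mul_comm, ← le_div_iff₀ hlam]
    exact min_le_right _ _
  generalize min θ (Real.pi / lam) = φ₀ at h0 h1 h2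
  have hsum := (tendsto_integral_remainderIntegrand_near hlam hθ hθπ hgrowth hf hw₀ h0 h1 h2).add
    (tendsto_integral_remainderIntegrand_far hlam hθπ hμ hgrowth hf w₀ h0)
  rw [add_zero] at hsum
  refine hsum.congr' ?_
  obtain ⟨c, hc, hq⟩ := exists_norm_one_add_div_sqrt_le hw₀
  have hs : Tendsto (fun p : ℕ × ℂ => Real.sqrt p.1) (atTop ×ˢ 𝓝 w₀) atTop :=
    tendsto_sqrt_natCast tendsto_fst
  filter_upwards [hq, hs.eventually_gt_atTop 0] with p hp hsp
  have hq1 : ‖1 + p.2 / (Real.sqrt p.1 : ℂ)‖ < 1 := by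
    have : 0 < c / Real.sqrt p.1 := by positivity
    linarith
  have hcont : Continuous (remainderIntegrand f a b lam p.1 p.2) := by
    unfold remainderIntegrand normalizedGrowth
    refine Continuous.mul (Continuous.div_const (by fun_prop) _)
      (Continuous.div (by fun_prop) (by fun_prop) fun φ h => ?_)
    have := norm_exp_mul_I_sub_ge φ (1 + p.2 / (Real.sqrt p.1 : ℂ))
    rw [h, norm_zero] at this
    linarith
  have hsub : Set.Icc (-φ₀) φ₀ ⊆ Set.Ioc (-Real.pi) Real.pi := fun φ hφ =>
    ⟨by linarith [hφ.1], by linarith [hφ.2]⟩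
  rw [intervalIntegral.integral_of_le (by linarith [Real.pi_pos]),
    ← integral_inter_add_sdiff measurableSet_Icc
      (hcont.integrableOn_Icc.mono_set Set.Ioc_subset_Icc_self) (t := Set.Icc (-φ₀) φ₀),
    Set.inter_eq_right.2 hsub]

/-! ### Assembly: local limits and compactness -/

theorem tendsto_sqrt_mul_log_one_add_div_sqrt (w₀ : ℂ) :
    Tendsto (fun p : ℕ × ℂ => (Real.sqrt p.1 : ℂ) * Complex.log (1 + p.2 / (Real.sqrt p.1 : ℂ)))
      (atTop ×ˢ 𝓝 w₀) (𝓝 w₀) := by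
  have hN : Tendsto (fun p : ℕ × ℂ => p.1) (atTop ×ˢ 𝓝 w₀) atTop := tendsto_fst
  have hw : Tendsto (fun p : ℕ × ℂ => p.2) (atTop ×ˢ 𝓝 w₀) (𝓝 w₀) := tendsto_snd
  refine tendsto_sqrt_mul_comp_of_hasDerivAt (g := fun x => Complex.log (1 + x)) ?_ (by simp) hN
    (hw.congr' ?_)
  · have h := ((hasDerivAt_id (0 : ℂ)).const_add 1).clog (by simp)
    simpa using h
  · filter_upwards [(tendsto_sqrt_natCast hN).eventually_gt_atTop 0] with p hp
    have hpC : (Real.sqrt p.1 : ℂ) ≠ 0 := by exact_mod_cast hp.ne'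
    field_simp

theorem eventually_cornerPoint_ne_zero_and_tendsto {f : ℂ → ℂ} {a b : ℂ} {lam θ μ : ℝ}
    (hlam : 0 < lam) (hθ : 0 < θ) (hθπ : θ < Real.pi) (hμ : μ < 1)
    (hgrowth : HasOneDirectionGrowth f a b lam θ μ) (hf : Differentiable ℂ f) {w₀ : ℂ}
    (hw₀ : w₀.re < 0) :
    (∀ᶠ p : ℕ × ℂ in atTop ×ˢ 𝓝 w₀, f (cornerPoint lam p.1 p.2) ≠ 0) ∧
    Tendsto (fun p : ℕ × ℂ =>
      maclaurinPartialSum f (p.1 - 1) (cornerPoint lam p.1 p.2) / f (cornerPoint lam p.1 p.2))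
      (atTop ×ˢ 𝓝 w₀) (𝓝 (1 / 2 * complexErfc (w₀ * (Real.sqrt (lam / 2) : ℂ)))) := by
  have hN : Tendsto (fun p : ℕ × ℂ => p.1) (atTop ×ˢ 𝓝 w₀) atTop := tendsto_fst
  have hs := tendsto_sqrt_natCast hN
  have hlog := tendsto_sqrt_mul_log_one_add_div_sqrt w₀
  have hH := tendsto_normalizedGrowth hlam hθ hθπ hgrowth hN hlog
  have hJ := tendsto_integral_remainderIntegrand hlam hθ hθπ hμ hgrowth hf.continuous hw₀
  have hHne := hH.eventually_ne (Complex.exp_ne_zero _)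
  obtain ⟨c, hc, hq⟩ := exists_norm_one_add_div_sqrt_le hw₀
  have hqne : ∀ᶠ p : ℕ × ℂ in atTop ×ˢ 𝓝 w₀, 1 + p.2 / (Real.sqrt p.1 : ℂ) ≠ 0 := by
    have h1 : Tendsto (fun p : ℕ × ℂ => ‖p.2 / (Real.sqrt p.1 : ℂ)‖) (atTop ×ˢ 𝓝 w₀) (𝓝 0) := by
      refine ((tendsto_snd (f := atTop) (g := 𝓝 w₀)).norm.div_atTop hs).congr fun p => ?_
      rw [norm_div, Complex.norm_real, Real.norm_of_nonneg (Real.sqrt_nonneg _)]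
    filter_upwards [h1.eventually_lt_const one_pos] with p hp h
    rw [← neg_eq_iff_add_eq_zero] at h
    rw [← h] at hp
    simp at hp
  have hr := ((tendsto_scalingRadius hlam).comp hN).eventually_gt_atTop 1
  have hexact : ∀ᶠ p : ℕ × ℂ in atTop ×ˢ 𝓝 w₀, f (cornerPoint lam p.1 p.2) =
      normalizedGrowth f a b lam p.1 (Complex.log (1 + p.2 / (Real.sqrt p.1 : ℂ))) *
        ((1 + p.2 / (Real.sqrt p.1 : ℂ)) ^ p.1 * growthScale a b lam p.1) := by
    filter_upwards [hqne, hr] with p h1 h2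
    have hM := growthScale_ne_zero (a := a) (b := b) h2
    simp only at hM
    rw [normalizedGrowth, Complex.exp_neg, Complex.exp_nat_mul, Complex.exp_log h1, cornerPoint]
    field_simp
  have hfne : ∀ᶠ p : ℕ × ℂ in atTop ×ˢ 𝓝 w₀, f (cornerPoint lam p.1 p.2) ≠ 0 := by
    filter_upwards [hexact, hHne, hqne, hr] with p h1 h2 h3 h4
    rw [h1]
    exact mul_ne_zero h2 (mul_ne_zero (pow_ne_zero _ h3) (growthScale_ne_zero h4))
  refine ⟨hfne, ?_⟩
  have hpi : (Real.pi : ℂ) ≠ 0 := by exact_mod_cast Real.pi_ne_zero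
  have hlim := ((hJ.div hH (Complex.exp_ne_zero _)).div_const (2 * Real.pi : ℂ)).const_sub 1
  -- The factors `exp(λw₀²/2)` cancel, leaving `1 - erfc(-w₀√(λ/2))/2`, to which the reflection
  -- formula applies.
  have hval : 1 - (∫ t : ℝ, Complex.exp (-(lam * t ^ 2 / 2)) / (t * Complex.I - w₀)) /
      Complex.exp (lam * w₀ ^ 2 / 2) / (2 * Real.pi) =
      1 / 2 * complexErfc (w₀ * (Real.sqrt (lam / 2) : ℂ)) := by
    have he := Complex.exp_ne_zero (lam * w₀ ^ 2 / 2)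
    have hsum := complexErfc_add_complexErfc_neg (w₀ * (Real.sqrt (lam / 2) : ℂ))
    rw [integral_gaussian_div_sub hlam hw₀]
    field_simp
    linear_combination -hsum
  rw [hval] at hlim
  refine hlim.congr' ?_
  filter_upwards [hexact, hHne, hqne, hr, hq, hs.eventually_gt_atTop 0,
    hN.eventually_ge_atTop 1, hfne] with p h1 h2 h3 h4 h5 h6 h7 h8
  have hM := growthScale_ne_zero (a := a) (b := b) h4
  simp only at hM
  have hq1 : ‖1 + p.2 / (Real.sqrt p.1 : ℂ)‖ < 1 := by
    have : 0 < c / Real.sqrt p.1 := by positivity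
    linarith
  have hrem := sub_sum_maclaurin_eq_integral hf (zero_lt_one.trans h4) hq1 p.1
  have hint : ∫ φ in (-Real.pi)..Real.pi,
      f (scalingRadius lam p.1 * Complex.exp (φ * Complex.I)) *
        Complex.exp (-(p.1 * (φ * Complex.I))) * (Complex.exp (φ * Complex.I) /
          (Complex.exp (φ * Complex.I) - (1 + p.2 / (Real.sqrt p.1 : ℂ)))) =
      growthScale a b lam p.1 *
        ∫ φ in (-Real.pi)..Real.pi, remainderIntegrand f a b lam p.1 p.2 φ := by
    rw [← intervalIntegral.integral_const_mul]
    refine intervalIntegral.integral_congr fun φ _ => ?_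
    simp only [remainderIntegrand, normalizedGrowth]
    rw [div_mul_eq_mul_div _ (growthScale a b lam p.1), mul_div_cancel₀ _ hM]
  simp only [Function.comp_apply] at hrem
  rw [hint] at hrem
  -- Degree `n - 1` means `n` terms, matching the Cauchy remainder of order `n`; the truncated
  -- subtraction needs `n ≥ 1`.
  rw [maclaurinPartialSum, Nat.sub_add_cancel h7, eq_div_iff h8, sub_mul, one_mul, Pi.div_apply,
    sub_eq_iff_eq_add', ← sub_eq_iff_eq_add]
  refine Eq.trans ?_ (hrem.trans ?_)
  · rfl
  · rw [h1]
    field_simp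

end

theorem mainTheorem1 (a b : ℂ) (lam θ μ : ℝ) (hlam : 0 < lam) (hθ : 0 < θ) (hθπ : θ < Real.pi)
    (hμ : μ < 1) (f : ℂ → ℂ) (hf : Differentiable ℂ f)
    (hgrowth : HasOneDirectionGrowth f a b lam θ μ)
    (K : Set ℂ) (hK : IsCompact K) (hKre : ∀ w ∈ K, w.re < 0) :
    (∀ᶠ n : ℕ in atTop, ∀ w ∈ K, f (cornerPoint lam n w) ≠ 0) ∧
    TendstoUniformlyOn
      (fun (n : ℕ) (w : ℂ) =>
        maclaurinPartialSum f (n - 1) (cornerPoint lam n w) / f (cornerPoint lam n w))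
      (fun w : ℂ => (1 / 2 : ℂ) * complexErfc (w * (Real.sqrt (lam / 2) : ℂ)))
      atTop K := by
  have hlocal := fun w (hw : w ∈ K) => eventually_cornerPoint_ne_zero_and_tendsto hlam hθ hθπ hμ
    hgrowth hf (hKre w hw)
  constructor
  · have h : ∀ᶠ p : ℕ × ℂ in atTop ×ˢ 𝓝ˢ K, f (cornerPoint lam p.1 p.2) ≠ 0 := by
      rw [hK.prod_nhdsSet_eq_biSup]
      simp only [eventually_iSup]
      exact fun w hw => (hlocal w hw).1
    exact h.curry.mono fun n hn w hw => hn.self_of_nhdsSet w hw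
  · rw [← tendstoLocallyUniformlyOn_iff_tendstoUniformlyOn_of_compact hK,
      tendstoLocallyUniformlyOn_iff_filter]
    intro w hw
    have hcont : Tendsto (fun p : ℕ × ℂ =>
        (1 / 2 : ℂ) * complexErfc (p.2 * (Real.sqrt (lam / 2) : ℂ))) (atTop ×ˢ 𝓝 w)
        (𝓝 (1 / 2 * complexErfc (w * (Real.sqrt (lam / 2) : ℂ)))) := by
      have h : Continuous fun z : ℂ =>
          (1 / 2 : ℂ) * complexErfc (z * (Real.sqrt (lam / 2) : ℂ)) :=
        continuous_const.mul (continuous_complexErfc.comp (continuous_mul_const _))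
      exact (h.tendsto w).comp tendsto_snd
    -- Both functions have the same joint limit at `(∞, w)`, so the pair tends to a diagonal point,
    -- whose neighbourhoods refine the uniformity.
    rw [tendstoUniformlyOnFilter_iff_tendsto]
    exact ((hcont.prodMk_nhds (hlocal w hw).2).mono_right (nhds_le_uniformity _)).mono_left
      (prod_mono le_rfl nhdsWithin_le_nhds)
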